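/- Let $R$ be a commutative Noetherian ring, let $\mathfrak m$ be a maximal ideal of $R$, and let $N$ be an $R$-module (not necessarily finitely generated) that is $\mathfrak m$-torsion, that is, each element of $N$ is annihilated by some power of $\mathfrak m$. Suppose that the localization $N_{\mathfrak m}$ is an injective $R_{\mathfrak m}$-module. Then $N$ is an injective $R$-module, and $$N \cong E(R/\mathfrak m)^{\mu^0(\mathfrak m, N)},$$ the direct sum of $\mu^0(\mathfrak m, N)$ copies of $E(R/\mathfrak m)$. Here $E(R/\mathfrak m)$ is the injective envelope of the $R$-module $R/\mathfrak m$, and $\mu^0(\mathfrak m, N)$ is the zeroth Bass number of $N$ at $\mathfrak m$, that is, the (possibly infinite) cardinal $\dim_{\kappa(\mathfrak m)} \operatorname{Hom}_{R_{\mathfrak m}}(\kappa(\mathfrak m), N_{\mathfrak m})$, where $\kappa(\mathfrak m) = R_{\mathfrak m}/\mathfrak m R_{\mathfrak m}$. -/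

import Mathlib

universe u v w

/-- `N` is `I`-torsion: each element of `N` is annihilated by some power of the ideal `I`. -/
def IsPowTorsion {R : Type u} [CommRing R] (I : Ideal R) (N : Type v) [AddCommGroup N]
    [Module R N] : Prop :=
  ∀ x : N, ∃ k : ℕ, ∀ a ∈ I ^ k, a • x = 0

/-- `f : M → E` exhibits `E` as an injective envelope of `M`: `E` is an injective module and `f` is
an essential monomorphism, that is, it is injective and every submodule of `E` that meets the image
of `f` trivially is zero. (`Module.Injective` tests against modules in the universe of `E`, so it
is the usual notion when `R` is small in that universe.) -/
structure IsInjectiveEnvelope {R : Type u} [CommRing R] {M : Type v} [AddCommGroup M] [Module R M]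
    {E : Type w} [AddCommGroup E] [Module R E] (f : M →ₗ[R] E) : Prop where
  injective_module : Module.Injective R E
  injective : Function.Injective f
  essential : ∀ S : Submodule R E, S ⊓ LinearMap.range f = ⊥ → S = ⊥

/-- Injective envelopes exist. -/
theorem exists_isInjectiveEnvelope (R : Type u) [CommRing R] (M : Type u) [AddCommGroup M]
    [Module R M] :
    ∃ (E : Type u) (_ : AddCommGroup E) (_ : Module R E) (f : M →ₗ[R] E),
      IsInjectiveEnvelope f := by
  obtain ⟨⟨J', hJ', ι, hι⟩⟩ :=
    (inferInstance : CategoryTheory.EnoughInjectives (ModuleCat.{u} R)).presentation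
      (ModuleCat.of R M)
  have hJ : Module.Injective R J' := Module.injective_module_of_injective_object R J'
  have hi : Function.Injective ι.hom := (ModuleCat.mono_iff_injective ι).1 hι
  generalize ι.hom = i at hi
  -- `P S`: the submodule `S` of `J'` is an essential extension of the image of `i`
  let P : Set (Submodule R J') := {S | LinearMap.range i ≤ S ∧
    ∀ x ∈ S, x ≠ 0 → ∃ r : R, r • x ≠ 0 ∧ r • x ∈ LinearMap.range i}
  obtain ⟨E, hME, hE⟩ := zorn_le_nonempty₀ P (fun c hc hch y hy => by
      refine ⟨sSup c, ⟨(hc hy).1.trans (le_sSup hy), fun x hx hx0 => ?_⟩, fun z hz => le_sSup hz⟩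
      obtain ⟨S, hS, hxS⟩ := (Submodule.mem_sSup_of_directed ⟨y, hy⟩ hch.directedOn).1 hx
      exact (hc hS).2 x hxS hx0)
    (LinearMap.range i) ⟨le_rfl, fun x hx hx0 => ⟨1, by simpa using hx0, by simpa using hx⟩⟩
  -- a maximal submodule `C` with zero intersection with `E`
  obtain ⟨C, -, hC⟩ := zorn_le_nonempty₀ {S : Submodule R J' | S ⊓ E = ⊥} (fun c hc hch y hy => by
      refine ⟨sSup c, ?_, fun z hz => le_sSup hz⟩
      refine (Submodule.eq_bot_iff _).2 fun x hx => ?_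
      obtain ⟨S, hS, hxS⟩ :=
        (Submodule.mem_sSup_of_directed ⟨y, hy⟩ hch.directedOn).1 (Submodule.mem_inf.1 hx).1
      exact (Submodule.eq_bot_iff _).1 (hc hS) x ⟨hxS, hx.2⟩) ⊥ (by simp)
  have hC0 : ∀ x ∈ C, x ∈ E → x = 0 := fun x hx hxE =>
    (Submodule.eq_bot_iff _).1 hC.prop x ⟨hx, hxE⟩
  have hj : Function.Injective (C.mkQ ∘ₗ E.subtype) := by
    rw [← LinearMap.ker_eq_bot, LinearMap.ker_eq_bot']
    rintro ⟨x, hx⟩ h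
    have : x ∈ C := by simpa using h
    exact Subtype.ext (hC0 x this hx)
  -- `E` is essential in `J' / C`
  have hess : ∀ x : J', x ∉ C → ∃ r : R, ∃ e ∈ E, e ≠ 0 ∧ r • x - e ∈ C := by
    intro x hx
    by_contra hcon
    push Not at hcon
    have hmem : (C ⊔ Submodule.span R {x}) ⊓ E = ⊥ := by
      refine (Submodule.eq_bot_iff _).2 fun e he => ?_
      obtain ⟨c, hc, y, hy, hcy⟩ := Submodule.mem_sup.1 he.1
      obtain ⟨r, rfl⟩ := Submodule.mem_span_singleton.1 hy
      by_contra he0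
      refine hcon r e he.2 he0 ?_
      rw [← hcy]
      simpa using hc
    exact hx (hC.le_of_ge hmem le_sup_left
      (le_sup_right (a := C) (Submodule.mem_span_singleton_self x)))
  obtain ⟨g, hg⟩ := hJ.out (C.mkQ ∘ₗ E.subtype) hj E.subtype
  have hgE : ∀ e ∈ E, g (C.mkQ e) = e := fun e he => hg ⟨e, he⟩
  have hle : LinearMap.range (g ∘ₗ C.mkQ) ≤ E := by
    have hEle : E ≤ LinearMap.range (g ∘ₗ C.mkQ) := fun e he => ⟨e, hgE e he⟩
    refine hE.le_of_ge (y := LinearMap.range (g ∘ₗ C.mkQ)) ⟨hE.prop.1.trans hEle, ?_⟩ hEle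
    rintro _ ⟨x, rfl⟩ hx0
    have hxC : x ∉ C := fun hx => hx0 (by
      rw [LinearMap.comp_apply, Submodule.mkQ_apply, (Submodule.Quotient.mk_eq_zero C).2 hx,
        map_zero])
    obtain ⟨r, e, he, he0, hre⟩ := hess x hxC
    have h1 : r • (g ∘ₗ C.mkQ) x = e := by
      rw [← map_smul, ← hgE e he, LinearMap.comp_apply]
      congr 1
      exact (Submodule.Quotient.eq C).2 hre
    obtain ⟨s, hs0, hs⟩ := hE.prop.2 e he he0
    exact ⟨s * r, by rwa [mul_smul, h1], by rwa [mul_smul, h1]⟩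
  let ρ : J' →ₗ[R] E := (g ∘ₗ C.mkQ).codRestrict E fun x => hle ⟨x, rfl⟩
  refine ⟨E, inferInstance, inferInstance, i.codRestrict E fun x => hE.prop.1 ⟨x, rfl⟩,
    ⟨⟨?_⟩, ?_, ?_⟩⟩
  · intro X Y _ _ _ _ f hf h
    obtain ⟨k, hk⟩ := hJ.out f hf (E.subtype ∘ₗ h)
    refine ⟨ρ ∘ₗ k, fun x => Subtype.ext ?_⟩
    have : g (C.mkQ (k (f x))) = h x := by rw [hk]; exact hgE _ (h x).2
    exact this
  · intro x y hxy
    exact hi (congrArg Subtype.val hxy)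
  · intro S hS
    refine (Submodule.eq_bot_iff _).2 fun x hx => ?_
    by_contra hx0
    obtain ⟨r, hr0, m, hm⟩ := hE.prop.2 x x.2 (fun h => hx0 (Subtype.ext h))
    refine hr0 (congrArg Subtype.val ((Submodule.eq_bot_iff _).1 hS (r • x)
      ⟨S.smul_mem r hx, m, Subtype.ext hm⟩))

/-- The zeroth Bass number `μ⁰(p, N) = dim Hom_{R_p}(κ(p), N_p)`, where the dimension is taken over
the residue field `κ(p) = R_p / p R_p` acting on `Hom` through its first argument. (Mathlib writes
`κ(p)ᵈᵐᵃ` for the copy of `κ(p)` that acts on maps through their domain.) It is a cardinal, not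
necessarily finite. -/
noncomputable def bassNumberZero {R : Type u} [CommRing R] (p : Ideal R) [p.IsPrime] (N : Type v)
    [AddCommGroup N] [Module R N] : Cardinal.{max u v} :=
  Module.rank (p.ResidueField)ᵈᵐᵃ
    (p.ResidueField →ₗ[Localization.AtPrime p] LocalizedModule p.primeCompl N)

/-! Injectivity over a Noetherian ring can be tested at maximal ideals: `N` localizes to zero away
from `m`, and at `m` injectivity is assumed. Elements outside `m` act bijectively on `N`, so `N` is
its own localization at `m`. A basis of `Hom(κ(m), N_m)` therefore identifies the socle of `N` (the
elements killed by `m`) with a direct sum of copies of `R / m`, and torsion makes this socle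
essential. The embedding of the socle into a sum of copies of `E` extends to `N`, because that sum
is Baer (`Module.Baer.finsupp`). The extension is injective since the socle is essential, splits
since `N` is injective, and is onto since the sum of copies of `R / m` is essential in the target.
-/

/-- Over a Noetherian ring, a direct sum of copies of a Baer module is a Baer module. -/
theorem Module.Baer.finsupp {R : Type*} [CommRing R] [IsNoetherianRing R] {E : Type*}
    [AddCommGroup E] [Module R E] (hE : Module.Baer R E) (ι : Type*) :
    Module.Baer R (ι →₀ E) := by
  classical
  intro I g
  obtain ⟨t, ht⟩ := (Module.Finite.fg_top : (⊤ : Submodule R I).FG)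
  -- Finite generation of `I` confines the values of `g` to finitely many coordinates, so only
  -- finitely many coordinatewise extensions must be added.
  have hsupp : ∀ x, g x ∈ Finsupp.supported E R (t.biUnion fun y => (g y).support : Set ι) := by
    intro x
    have hle : Submodule.span R (t : Set I) ≤
        (Finsupp.supported E R (t.biUnion fun y => (g y).support : Set ι)).comap g := by
      refine Submodule.span_le.2 fun y hy => ?_
      exact (Finsupp.mem_supported R _).2
        (Finset.coe_subset.2 (Finset.subset_biUnion_of_mem (fun y => (g y).support) hy))
    exact hle (ht ▸ Submodule.mem_top)
  choose h hh using fun i : ι => hE I (Finsupp.lapply i ∘ₗ g)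
  refine ⟨∑ i ∈ t.biUnion fun y => (g y).support, Finsupp.lsingle i ∘ₗ h i, fun x hx => ?_⟩
  ext i
  by_cases hi : i ∈ t.biUnion fun y => (g y).support
  · rw [LinearMap.sum_apply, Finsupp.finsetSum_apply, Finset.sum_eq_single_of_mem i hi]
    · simp [hh _ x hx]
    · intro j _ hji
      simp [hji]
  · have h0 : g ⟨x, hx⟩ i = 0 := by
      by_contra hne
      exact hi (Finset.mem_coe.1
        ((Finsupp.mem_supported R _).1 (hsupp ⟨x, hx⟩) (Finsupp.mem_support_iff.2 hne)))
    rw [h0, LinearMap.sum_apply, Finsupp.finsetSum_apply]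
    refine Finset.sum_eq_zero fun j hj => ?_
    have hji : j ≠ i := fun h => hi (h ▸ hj)
    simp [hji]

theorem IsInjectiveEnvelope.exists_smul_mem_range {R : Type*} [CommRing R] {M : Type*}
    [AddCommGroup M] [Module R M] {E : Type*} [AddCommGroup E] [Module R E] {f : M →ₗ[R] E}
    (hf : IsInjectiveEnvelope f) {x : E} (hx : x ≠ 0) :
    ∃ r : R, r • x ≠ 0 ∧ r • x ∈ LinearMap.range f := by
  by_contra! hcon
  refine hx (Submodule.span_singleton_eq_bot.1 (hf.essential (Submodule.span R {x}) ?_))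
  refine (Submodule.eq_bot_iff _).2 ?_
  rintro y ⟨hy, hyf⟩
  obtain ⟨r, rfl⟩ := Submodule.mem_span_singleton.1 hy
  by_contra h0
  exact hcon r h0 hyf

/-- A direct sum of copies of an essential submodule is essential. -/
theorem Finsupp.exists_smul_forall_mem {R : Type*} [CommRing R] {E : Type*} [AddCommGroup E]
    [Module R E] {P : Submodule R E} (hP : ∀ x : E, x ≠ 0 → ∃ r : R, r • x ≠ 0 ∧ r • x ∈ P)
    {ι : Type*} {c : ι →₀ E} (hc : c ≠ 0) : ∃ r : R, r • c ≠ 0 ∧ ∀ i, (r • c) i ∈ P := by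
  classical
  have key : ∀ s : Finset ι, ∃ r : R, r • c ≠ 0 ∧ ∀ i ∈ s, (r • c) i ∈ P := by
    intro s
    induction s using Finset.induction_on with
    | empty => exact ⟨1, by simpa using hc, by simp⟩
    | insert j s _ ih =>
      obtain ⟨r, hr, hs⟩ := ih
      by_cases hj : (r • c) j = 0
      · refine ⟨r, hr, fun i hi => ?_⟩
        rcases Finset.mem_insert.1 hi with rfl | hi
        · rw [hj]
          exact P.zero_mem
        · exact hs i hi
      -- Multiplying by `t` keeps the earlier coordinates in `P`, and coordinate `j` shows that the
      -- product is nonzero.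
      · obtain ⟨t, ht, htP⟩ := hP _ hj
        refine ⟨t * r, fun h => ht ?_, fun i hi => ?_⟩
        · rw [← Finsupp.smul_apply, ← mul_smul, h, Finsupp.zero_apply]
        · rw [mul_smul, Finsupp.smul_apply]
          rcases Finset.mem_insert.1 hi with rfl | hi
          · exact htP
          · exact P.smul_mem t (hs i hi)
  obtain ⟨r, hr, h⟩ := key c.support
  refine ⟨r, hr, fun i => ?_⟩
  by_cases hi : i ∈ c.support
  · exact h i hi
  · rw [Finsupp.smul_apply, Finsupp.notMem_support_iff.1 hi, smul_zero]
    exact P.zero_mem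

/-- A Baer module that is an essential extension of a direct sum of copies of `M` is a direct sum
of copies of the injective envelope of `M`. -/
theorem IsInjectiveEnvelope.nonempty_linearEquiv_finsupp {R : Type*} [CommRing R]
    [IsNoetherianRing R] {M E N ι : Type*} [AddCommGroup M] [Module R M] [AddCommGroup E]
    [Module R E] [AddCommGroup N] [Module R N] {f : M →ₗ[R] E} (hf : IsInjectiveEnvelope f)
    (hE : Module.Baer R E) (hN : Module.Baer R N) {ψ : (ι →₀ M) →ₗ[R] N}
    (hψ : Function.Injective ψ)
    (hess : ∀ x : N, x ≠ 0 → ∃ r : R, r • x ≠ 0 ∧ r • x ∈ LinearMap.range ψ) :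
    Nonempty (N ≃ₗ[R] (ι →₀ E)) := by
  have hfι : Function.Injective (Finsupp.mapRange.linearMap (α := ι) f) :=
    Finsupp.mapRange_injective f f.map_zero hf.injective
  obtain ⟨φ, hφ⟩ := (hE.finsupp ι).extension_property ψ hψ (Finsupp.mapRange.linearMap f)
  have hφψ : ∀ y, φ (ψ y) = Finsupp.mapRange.linearMap f y := fun y => LinearMap.congr_fun hφ y
  have hφinj : Function.Injective φ := by
    refine (injective_iff_map_eq_zero φ).2 fun x hx => ?_
    by_contra hx0
    obtain ⟨r, hr, y, hy⟩ := hess x hx0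
    have : Finsupp.mapRange.linearMap f y = 0 := by
      rw [← hφψ, hy, map_smul, hx, smul_zero]
    rw [← map_zero (Finsupp.mapRange.linearMap (α := ι) f)] at this
    exact hr (by rw [← hy, hfι this, map_zero])
  obtain ⟨π, hπ⟩ := hN.extension_property φ hφinj LinearMap.id
  have hπφ : ∀ x, π (φ x) = x := fun x => LinearMap.congr_fun hπ x
  refine ⟨LinearEquiv.ofBijective φ ⟨hφinj, fun z => ⟨π z, ?_⟩⟩⟩
  -- `π` kills `φ (π z) - z`, but a nonzero multiple of it lies in the image of `φ ∘ ψ`, where `π`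
  -- is injective.
  by_contra hne
  obtain ⟨r, hr, hmem⟩ := Finsupp.exists_smul_forall_mem
    (fun _ h => hf.exists_smul_mem_range h) (sub_ne_zero.2 hne)
  choose y hy using hmem
  have hy0 : ∀ i, y i ≠ 0 → i ∈ (r • (φ (π z) - z)).support := by
    intro i hi
    rw [Finsupp.mem_support_iff, ← hy]
    exact fun h => hi (hf.injective (h.trans f.map_zero.symm))
  have hY : φ (ψ (Finsupp.onFinset _ y hy0)) = r • (φ (π z) - z) := by
    rw [hφψ]
    ext i
    simpa using hy i
  have h0 : ψ (Finsupp.onFinset _ y hy0) = 0 := by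
    rw [← hπφ (ψ _), hY, map_smul, map_sub, hπφ, sub_self, smul_zero]
  exact hr (by rw [← hY, h0, map_zero])

namespace IsPowTorsion

variable {R : Type*} [CommRing R] {I m : Ideal R} {N : Type*} [AddCommGroup N] [Module R N]

/-- The `I`-socle of an `I`-torsion module is essential. -/
theorem exists_smul_ne_zero (hN : IsPowTorsion I N) {x : N} (hx : x ≠ 0) :
    ∃ r : R, r • x ≠ 0 ∧ ∀ a ∈ I, a • r • x = 0 := by
  classical
  have hex : ∃ k : ℕ, ∀ a ∈ I ^ k, a • x = 0 := hN x
  obtain ⟨k, hk⟩ : ∃ k, Nat.find hex = k + 1 := by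
    refine Nat.exists_eq_succ_of_ne_zero fun h => hx ?_
    have := Nat.find_spec hex
    rw [h] at this
    simpa using this 1 (by simp)
  -- By minimality of `k + 1`, some `r ∈ I ^ k` does not kill `x`, while `I * r` lies in `I ^ (k +
  -- 1)`.
  have hmin := Nat.find_min hex (m := k) (by omega)
  push Not at hmin
  obtain ⟨r, hr, hr0⟩ := hmin
  refine ⟨r, hr0, fun a ha => ?_⟩
  rw [← mul_smul]
  refine Nat.find_spec hex _ ?_
  rw [hk, pow_succ']
  exact Ideal.mul_mem_mul ha hr

/-- An element outside a maximal ideal acts invertibly on a module that is torsion for it. -/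
theorem exists_mul_smul_eq [m.IsMaximal] (hN : IsPowTorsion m N) {s : R} (hs : s ∉ m) (x : N) :
    ∃ t : R, (t * s) • x = x := by
  obtain ⟨k, hk⟩ := hN x
  -- Coprimality gives `1 = t * s + b` with `b ∈ m ^ k`, and `b` kills `x`.
  have hcop : IsCoprime (Ideal.span {s}) (m ^ k) := by
    refine IsCoprime.pow_right ?_
    rw [Ideal.isCoprime_iff_sup_eq, sup_comm]
    exact Ideal.IsMaximal.out.2 _
      (left_lt_sup.2 fun h => hs (h (Ideal.mem_span_singleton_self s)))
  obtain ⟨a, ha, b, hb, hab⟩ := Ideal.isCoprime_iff_exists.1 hcop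
  obtain ⟨t, rfl⟩ := Ideal.mem_span_singleton'.1 ha
  refine ⟨t, ?_⟩
  have := congrArg (· • x) hab
  simpa [add_smul, hk b hb] using this

theorem bijective_mkLinearMap [m.IsMaximal] (hN : IsPowTorsion m N) :
    Function.Bijective (LocalizedModule.mkLinearMap m.primeCompl N) := by
  constructor
  · refine (injective_iff_map_eq_zero _).2 fun x hx => ?_
    obtain ⟨s, hs⟩ := (IsLocalizedModule.eq_zero_iff m.primeCompl _).1 hx
    obtain ⟨t, ht⟩ := hN.exists_mul_smul_eq s.2 x
    rw [← ht, mul_smul]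
    exact (congrArg (t • ·) hs).trans (smul_zero t)
  · intro y
    obtain ⟨⟨x, s⟩, rfl⟩ :=
      IsLocalizedModule.mk'_surjective m.primeCompl (LocalizedModule.mkLinearMap m.primeCompl N) y
    obtain ⟨t, ht⟩ := hN.exists_mul_smul_eq s.2 x
    refine ⟨t • x, ?_⟩
    refine ((IsLocalizedModule.mk'_eq_iff).2 ?_).symm
    rw [Submonoid.smul_def, ← map_smul, ← mul_smul, mul_comm, ht]

/-- Away from `m`, the localization of an `m`-torsion module vanishes. -/
theorem subsingleton_localizedModule (hN : IsPowTorsion I N) {p : Ideal R} [p.IsPrime]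
    (hp : ¬ I ≤ p) : Subsingleton (LocalizedModule p.primeCompl N) := by
  obtain ⟨s, hsI, hsp⟩ := SetLike.not_le_iff_exists.1 hp
  refine LocalizedModule.subsingleton_iff.2 fun x => ?_
  obtain ⟨k, hk⟩ := hN x
  exact ⟨s ^ k, p.primeCompl.pow_mem hsp k, hk _ (Ideal.pow_mem_pow hsI k)⟩

end IsPowTorsion

theorem IsPowTorsion.injective {R : Type u} [CommRing R] [IsNoetherianRing R] {m : Ideal R}
    [m.IsMaximal] {N : Type v} [AddCommGroup N] [Module R N] [Small.{v} R]
    (hN : IsPowTorsion m N)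
    (hinj : Module.Injective (Localization.AtPrime m) (LocalizedModule m.primeCompl N)) :
    Module.Injective R N := by
  refine Module.injective_of_localization_maximal fun p hp => ?_
  by_cases h : m = p
  · subst h
    exact hinj
  · have := hN.subsingleton_localizedModule (p := p)
      fun hle => h (Ideal.IsMaximal.eq_of_le ‹_› hp.ne_top hle)
    exact ⟨fun _ _ _ _ _ _ _ _ _ => ⟨0, fun _ => Subsingleton.elim _ _⟩⟩

/-- A basis of `Hom(κ(m), L)` over `κ(m)` embeds a direct sum of copies of `R / m` into `L`, with
image the elements of `L` annihilated by `m`. -/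
theorem exists_finsupp_quotient_linearMap {R : Type u} [CommRing R] (m : Ideal R) [m.IsMaximal]
    (L : Type v) [AddCommGroup L] [Module R L] [Module (Localization.AtPrime m) L]
    [IsScalarTower R (Localization.AtPrime m) L] {ι : Type*}
    (b : Module.Basis ι (m.ResidueField)ᵈᵐᵃ (m.ResidueField →ₗ[Localization.AtPrime m] L)) :
    ∃ ψ : (ι →₀ R ⧸ m) →ₗ[R] L, Function.Injective ψ ∧
      ∀ y : L, (∀ a ∈ m, a • y = 0) → y ∈ LinearMap.range ψ := by
  let q : (R ⧸ m) ≃+ (m.ResidueField)ᵈᵐᵃ :=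
    (AddEquiv.ofBijective (algebraMap (R ⧸ m) m.ResidueField)
      m.bijective_algebraMap_quotient_residueField).trans
    { DomMulAct.mk with map_add' := fun _ _ => rfl }
  let e : (ι →₀ R ⧸ m) ≃+ (m.ResidueField →ₗ[Localization.AtPrime m] L) :=
    (Finsupp.mapRange.addEquiv q).trans b.repr.symm.toAddEquiv
  have hq : ∀ (r : R) (x : R ⧸ m),
      q (r • x) = DomMulAct.mk (algebraMap R m.ResidueField r) * q x := by
    intro r x
    change DomMulAct.mk (algebraMap (R ⧸ m) m.ResidueField (r • x)) =
      DomMulAct.mk _ * DomMulAct.mk (algebraMap (R ⧸ m) m.ResidueField x)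
    rw [← DomMulAct.mk_mul, Algebra.smul_def, map_mul, mul_comm,
      ← IsScalarTower.algebraMap_apply]
  have he : ∀ (r : R) (x : ι →₀ R ⧸ m),
      e (r • x) = DomMulAct.mk (algebraMap R m.ResidueField r) • e x := by
    intro r x
    have : Finsupp.mapRange.addEquiv q (r • x) =
        DomMulAct.mk (algebraMap R m.ResidueField r) • Finsupp.mapRange.addEquiv q x := by
      ext i
      simpa using hq r (x i)
    simp only [e, AddEquiv.trans_apply, this]
    exact map_smul b.repr.symm _ _
  -- Evaluation at `1` is injective because `1` generates `κ(m)` over `R_m`.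
  refine ⟨{ toFun := fun x => e x 1, map_add' := by simp, map_smul' := ?_ }, ?_, ?_⟩
  · intro r x
    rw [he]
    change e x (algebraMap R m.ResidueField r • 1) = r • e x 1
    rw [← algebraMap_smul (Localization.AtPrime m) r (e x 1), ← map_smul]
    congr 1
  · intro x y hxy
    refine e.injective (LinearMap.ext fun z => ?_)
    obtain ⟨z, rfl⟩ := IsLocalRing.residue_surjective z
    have hz : IsLocalRing.residue (Localization.AtPrime m) z = z • (1 : m.ResidueField) :=
      Algebra.algebraMap_eq_smul_one z
    have hxy' : e x 1 = e y 1 := hxy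
    rw [hz, map_smul, map_smul, hxy']
  · intro y hy
    -- Since `m` kills `y`, the map `R_m → L` sending `1` to `y` factors through `κ(m)`.
    have hle : IsLocalRing.maximalIdeal (Localization.AtPrime m) ≤
        LinearMap.ker (LinearMap.toSpanSingleton (Localization.AtPrime m) L y) := by
      rw [← Localization.AtPrime.map_eq_maximalIdeal]
      refine Ideal.map_le_iff_le_comap.2 fun a ha => ?_
      simpa using hy a ha
    let g : m.ResidueField →ₗ[Localization.AtPrime m] L := Submodule.liftQ _ _ hle
    refine ⟨e.symm g, ?_⟩
    have : g 1 = y :=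
      (Submodule.liftQ_apply _ _ (1 : Localization.AtPrime m)).trans (by simp)
    simpa using this

theorem nonempty_basis_bassNumberZero {R : Type u} [CommRing R] (p : Ideal R) [p.IsPrime]
    (N : Type v) [AddCommGroup N] [Module R N] :
    Nonempty (Module.Basis (bassNumberZero p N).out (p.ResidueField)ᵈᵐᵃ
      (p.ResidueField →ₗ[Localization.AtPrime p] LocalizedModule p.primeCompl N)) := by
  -- The division ring structure makes the `Hom` space free, so its rank is the size of a basis.
  let : DivisionRing (p.ResidueField)ᵈᵐᵃ := (inferInstance : DivisionRing (p.ResidueField)ᵐᵒᵖ)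
  let b := Module.Free.chooseBasis (p.ResidueField)ᵈᵐᵃ
    (p.ResidueField →ₗ[Localization.AtPrime p] LocalizedModule p.primeCompl N)
  have h : Cardinal.mk _ = bassNumberZero p N := b.mk_eq_rank''
  exact ⟨b.reindex (Cardinal.eq.1 (h.trans (Cardinal.mk_out _).symm)).some⟩

theorem lemma6p2 {R : Type u} [CommRing R] [IsNoetherianRing R] (m : Ideal R) [m.IsMaximal]
    (N : Type v) [AddCommGroup N] [Module R N] [Small.{v} R]
    (hN : IsPowTorsion m N)
    (hinj : Module.Injective (Localization.AtPrime m) (LocalizedModule m.primeCompl N)) :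
    Module.Injective R N ∧
      ∀ (E : Type w) [AddCommGroup E] [Module R E] [Small.{w} R] (f : (R ⧸ m) →ₗ[R] E),
        IsInjectiveEnvelope f →
          Nonempty (N ≃ₗ[R] ((bassNumberZero m N).out →₀ E)) := by
  have hNinj := hN.injective hinj
  refine ⟨hNinj, fun E _ _ _ f hf => ?_⟩
  let F := LinearEquiv.ofBijective _ hN.bijective_mkLinearMap
  obtain ⟨b⟩ := nonempty_basis_bassNumberZero m N
  obtain ⟨ψ, hψ, hψr⟩ := exists_finsupp_quotient_linearMap m _ b
  -- Smallness of `R` lets `Module.Injective` test inclusions of ideals, which yields the Baer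
  -- property.
  refine hf.nonempty_linearEquiv_finsupp (.of_injective hf.injective_module)
    (.of_injective hNinj) (ψ := F.symm.toLinearMap ∘ₗ ψ) (F.symm.injective.comp hψ) ?_
  intro x hx
  obtain ⟨r, hr, hsoc⟩ := hN.exists_smul_ne_zero hx
  obtain ⟨y, hy⟩ := hψr (F (r • x)) fun a ha => by rw [← map_smul, hsoc a ha, map_zero]
  exact ⟨r, hr, y, by simp [hy]⟩
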